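/- For an undirected simple graph $G$ and distinct vertices $u,v$ of $G$, let $\kappa_G(u,v)$ be the maximum number of pairwise internally vertex-disjoint paths between $u$ and $v$ (the edge $uv$, if present, counts as one path). For integers $n,k\ge 0$ and $\epsilon\in(0,1)$, an $(n,k,\epsilon)$-data structure $\mathscr{D}$ stores every undirected graph $G$ with vertex set $\{1,\dots,n\}$ as a finite string of bits, from which alone it answers every query $(u,v)$ with $u\ne v$ by a bit, such that the answer is $0$ whenever $\kappa_G(u,v)<(1-\epsilon)k$ and $1$ whenever $\kappa_G(u,v)>(1+\epsilon)k$ (it is arbitrary otherwise). The space of $\mathscr{D}$ is the maximum length of the stored string over all graphs $G$ on $\{1,\dots,n\}$. There are $k=k(n)=\Theta(n)$ and $\epsilon=\epsilon(n)=\Theta(1/\sqrt n)$, with $k(n)$ a nonnegative integer and $0<\epsilon(n)<1$, such that every $(n,k(n),\epsilon(n))$-data structure requires $\Omega(n\epsilon^{-2})$ bits of space; that is, there are constants $c>0$ and $n_0$ such that for every $n\ge n_0$, every $(n,k(n),\epsilon(n))$-data structure has space at least $c\,n\,\epsilon(n)^{-2}$. -/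

import Mathlib

open Filter Asymptotics

/-- A set of `u`-`v` paths is internally disjoint if two distinct members
share no vertex other than the endpoints `u` and `v`. -/
def InternallyDisjoint {V : Type*} {G : SimpleGraph V} {u v : V} (P : Set (G.Path u v)) : Prop :=
  P.Pairwise fun p q => ∀ w, w ∈ p.1.support → w ∈ q.1.support → w = u ∨ w = v

/-- `vertexConn G u v` is `κ(u,v)`: the maximum number of pairwise internally vertex-disjoint
paths between `u` and `v`. An edge `uv`, if present, counts as one such path.
Only used for distinct vertices of a finite graph, where the maximum exists. -/
noncomputable def vertexConn {V : Type*} (G : SimpleGraph V) (u v : V) : ℕ :=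
  sSup {m : ℕ | ∃ P : Finset (G.Path u v), P.card = m ∧ InternallyDisjoint (P : Set (G.Path u v))}

/-- On a finite graph the supremum in `vertexConn` is attained, so it is a maximum. -/
theorem vertexConn_isGreatest {V : Type*} [Finite V] (G : SimpleGraph V) (u v : V) :
    IsGreatest {m : ℕ | ∃ P : Finset (G.Path u v),
      P.card = m ∧ InternallyDisjoint (P : Set (G.Path u v))} (vertexConn G u v) := by
  classical
  have := Fintype.ofFinite V
  have hf : Finite (G.Path u v) := by
    refine Finite.of_injective
      (fun p : G.Path u v => (⟨p.1.support, p.2.support_nodup⟩ : {l : List V // l.Nodup})) ?_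
    intro p q h
    exact Subtype.ext (SimpleGraph.Walk.ext_support (congrArg Subtype.val h))
  have := Fintype.ofFinite (G.Path u v)
  have hb : BddAbove {m : ℕ | ∃ P : Finset (G.Path u v),
      P.card = m ∧ InternallyDisjoint (P : Set (G.Path u v))} := by
    refine ⟨Fintype.card (G.Path u v), ?_⟩
    rintro m ⟨P, rfl, -⟩
    exact P.card_le_univ
  have hne : {m : ℕ | ∃ P : Finset (G.Path u v),
      P.card = m ∧ InternallyDisjoint (P : Set (G.Path u v))}.Nonempty :=
    ⟨0, ∅, rfl, by simp [InternallyDisjoint]⟩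
  exact ⟨Nat.sSup_mem hne hb, fun m hm => le_csSup hb hm⟩

/-- A data structure for undirected graphs on `n` labelled vertices, for the threshold `k` and
the accuracy `ε`. Preprocessing turns the graph `G` into a string of bits `encode G`; a query
`(u, v)` with `u ≠ v` is answered from these bits alone (by an arbitrary function of them,
which may depend on `n`, `k`, `ε`). The answer has to be `false` if `κ(u,v) < (1-ε)k` and `true`
if `κ(u,v) > (1+ε)k`, and is arbitrary otherwise. -/
structure ApproxConnDS (n k : ℕ) (ε : ℝ) where
  encode : SimpleGraph (Fin n) → List Bool
  query : List Bool → Fin n → Fin n → Bool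
  query_of_lt : ∀ (G : SimpleGraph (Fin n)) (u v : Fin n), u ≠ v →
    (vertexConn G u v : ℝ) < (1 - ε) * k → query (encode G) u v = false
  query_of_gt : ∀ (G : SimpleGraph (Fin n)) (u v : Fin n), u ≠ v →
    (1 + ε) * k < (vertexConn G u v : ℝ) → query (encode G) u v = true

/-- The number of bits of space that the data structure uses in the worst case, i.e. the
maximum length of `encode G` over all graphs `G` on `n` labelled vertices. -/
noncomputable def ApproxConnDS.space {n k : ℕ} {ε : ℝ} (D : ApproxConnDS n k ε) : ℕ :=
  (Set.finite_univ (α := SimpleGraph (Fin n))).toFinset.sup fun G => (D.encode G).length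

/-! Put `m = 2 ^ (r + 1)`. The hard graphs are split graphs on `4 * m` vertices plus isolated ones:
a clique of `m` data vertices and `m` test vertices, and an independent set of `m` pairs. Each
clique vertex carries a sign vector of length `m`, which selects one vertex of each pair. Data
vectors are arbitrary; test vectors are the rows of a Hadamard matrix. Connectivity between clique
vertices is affine in the inner product of their vectors (`vertexConn_rowGraph_map`), and `k` is its
value at inner product zero. So queries reveal the signs of the Hadamard transform of each data
vector, up to errors at entries of size `O(√m)`.

For at least half of all vectors the transform has large l1 norm (`le_sum_abs_rowCorr`). Such a
vector, if consistent with given answers, correlates strongly with the transform of the answer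
pattern; by Hoeffding only a fraction `exp (-m / 8192)` of all vectors does so
(`card_consistent_le`). With `m` independent data vectors, one stored string serves at most a
fraction `exp (-m ^ 2 / 8192)` of the inputs, while at least `2 ^ (-m)` of them are typical. Hence
`Ω(m ^ 2)` bits are needed. -/

/-! ### Connectivity in split graphs. -/

/-- In a split graph (a clique `Q` whose complement is independent), the connectivity of two
clique vertices is one more than the number of their common neighbours. -/
theorem vertexConn_of_split {V : Type*} [Finite V] (G : SimpleGraph V) (Q : Set V)
    (hQ : ∀ a ∈ Q, ∀ b ∈ Q, a ≠ b → G.Adj a b)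
    (hW : ∀ a ∉ Q, ∀ b ∉ Q, ¬ G.Adj a b) {u v : V} (hu : u ∈ Q) (hv : v ∈ Q) (huv : u ≠ v) :
    vertexConn G u v = (G.commonNeighbors u v).ncard + 1 := by
  classical
  have := Fintype.ofFinite V
  have hG := vertexConn_isGreatest G u v
  have hcard : Fintype.card (Option (G.commonNeighbors u v)) =
      (G.commonNeighbors u v).ncard + 1 := by
    rw [Fintype.card_option, Set.ncard_eq_toFinset_card', Set.toFinset_card]
  apply le_antisymm
  · obtain ⟨P, hP, hd⟩ := hG.1
    rw [← hP, ← hcard]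
    -- A path other than the edge `uv` has a common neighbour among its first two vertices after
    -- `u`: the first of these if it lies in `Q` or is followed by `v`, otherwise the second.
    -- Disjointness makes the choice injective.
    have key : ∀ p : G.Path u v, ∃ o : Option (G.commonNeighbors u v),
        (o = none → p.1.support = [u, v]) ∧ ∀ w, o = some w → w.1 ∈ p.1.support := by
      rintro ⟨p, hp⟩
      cases p with
      | nil => exact absurd rfl huv
      | @cons _ a _ h p =>
        by_cases hav : a = v
        · subst hav
          refine ⟨none, fun _ => ?_, by simp⟩
          have h1 : p.IsPath := hp.of_cons
          have h2 := (SimpleGraph.Walk.isPath_iff_nil.1 h1).eq_nil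
          subst h2
          simp
        · by_cases haQ : a ∈ Q
          · exact ⟨some ⟨a, h, hQ _ hv _ haQ (Ne.symm hav)⟩, by simp, by simp⟩
          · cases p with
            | nil => exact absurd rfl hav
            | @cons _ b _ h' p =>
              have hbQ : b ∈ Q := by
                by_contra hb
                exact hW a haQ b hb h'
              by_cases hbv : b = v
              · subst hbv
                exact ⟨some ⟨a, h, h'.symm⟩, by simp, by simp⟩
              · have hbu : u ≠ b := by
                  rintro rfl
                  have := hp.support_nodup
                  simp at this
                exact ⟨some ⟨b, hQ _ hu _ hbQ hbu, hQ _ hv _ hbQ (Ne.symm hbv)⟩, by simp, by simp⟩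
    choose f hf0 hf1 using key
    rw [← Finset.card_univ]
    refine Finset.card_le_card_of_injOn f (fun _ _ => Finset.mem_univ _) ?_
    intro p hp q hq hpq
    by_contra hne
    cases hfp : f p with
    | none =>
      refine hne (Subtype.ext (SimpleGraph.Walk.ext_support ?_))
      rw [hf0 p hfp, hf0 q (hpq ▸ hfp)]
    | some w =>
      obtain h | h := hd hp hq hne w.1 (hf1 p w hfp) (hf1 q w (hpq ▸ hfp))
      · exact G.loopless.irrefl _ (h ▸ w.2.1)
      · exact G.loopless.irrefl _ (h ▸ w.2.2)
  · apply hG.2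
    have hC : ∀ w : G.commonNeighbors u v, G.Adj u w.1 ∧ G.Adj v w.1 := fun w => w.2
    let g : Option (G.commonNeighbors u v) → G.Path u v := fun o =>
      match o with
      | none => ⟨.cons (hQ u hu v hv huv) .nil, by simp [huv]⟩
      | some w => ⟨.cons (hC w).1 (.cons (hC w).2.symm .nil), by
          have h1 : u ≠ w.1 := (hC w).1.ne
          have h2 : w.1 ≠ v := (hC w).2.ne'
          simp [huv, h1, h2]⟩
    have g0 : (g none).1.support = [u, v] := rfl
    have g1 : ∀ w, (g (some w)).1.support = [u, w.1, v] := fun _ => rfl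
    have hg : Function.Injective g := by
      intro o o' h
      have h : (g o).1.support = (g o').1.support := by rw [h]
      rcases o with _ | w <;> rcases o' with _ | w'
      · rfl
      · simp [g0, g1] at h
      · simp [g0, g1] at h
      · simp only [g1, List.cons.injEq, and_true, true_and] at h
        rw [Subtype.ext h]
    refine ⟨Finset.univ.image g, ?_, ?_⟩
    · rw [Finset.card_image_of_injective _ hg, Finset.card_univ, hcard]
    · intro p hp q hq hne w hw hw'
      simp only [Finset.coe_image, Finset.coe_univ, Set.image_univ, Set.mem_range] at hp hq
      obtain ⟨o, rfl⟩ := hp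
      obtain ⟨o', rfl⟩ := hq
      rcases o with _ | a <;> rcases o' with _ | b
      · simpa [g0] using hw
      · simpa [g0] using hw
      · simpa [g0] using hw'
      · have hab : a.1 ≠ b.1 := fun h => hne (by rw [Subtype.ext h])
        simp only [g1, List.mem_cons, List.not_mem_nil, or_false] at hw hw'
        grind

/-! ### Hadamard matrices. -/

/-- The sign `±1` of a bit. -/
def bitSign (b : Bool) : ℝ := if b then 1 else -1

theorem bitSign_sq (b : Bool) : bitSign b ^ 2 = 1 := by cases b <;> simp [bitSign]

/-- The Sylvester–Hadamard matrix with rows and columns indexed by bit vectors. -/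
def sylvester (r : ℕ) (a b : Fin r → Bool) : Bool :=
  decide (∏ i, (if a i && b i then (-1 : ℤ) else 1) = 1)

theorem bitSign_sylvester (r : ℕ) (a b : Fin r → Bool) :
    bitSign (sylvester r a b) = ∏ i, (if a i && b i then (-1 : ℝ) else 1) := by
  have h : (∏ i, (if a i && b i then (-1 : ℤ) else 1) = 1) ∨
      (∏ i, (if a i && b i then (-1 : ℤ) else 1) = -1) := by
    apply Int.isUnit_iff.1
    rw [IsUnit.prod_univ_iff]
    intro i
    split_ifs <;> simp
  have h2 : (∏ i, (if a i && b i then (-1 : ℝ) else 1)) =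
      ((∏ i, (if a i && b i then (-1 : ℤ) else 1) : ℤ) : ℝ) := by
    push_cast
    rfl
  rw [h2, bitSign, sylvester]
  rcases h with h | h <;> rw [h] <;> norm_num

theorem sylvester_comm (r : ℕ) (a b : Fin r → Bool) : sylvester r a b = sylvester r b a := by
  simp only [sylvester, Bool.and_comm]

/-- The sum factors over coordinates; one where `a` and `a'` differ contributes `1 - 1 = 0`. -/
theorem sylvester_orthogonal (r : ℕ) (a a' : Fin r → Bool) :
    ∑ b, bitSign (sylvester r a b) * bitSign (sylvester r a' b) =
      if a = a' then (2 : ℝ) ^ r else 0 := by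
  simp only [bitSign_sylvester, ← Finset.prod_mul_distrib]
  rw [← Fintype.prod_sum (fun (i : Fin r) (c : Bool) =>
    (if a i && c then (-1 : ℝ) else 1) * (if a' i && c then (-1 : ℝ) else 1))]
  split_ifs with h
  · subst h
    have : ∀ i, ∑ c : Bool, (if a i && c then (-1 : ℝ) else 1) *
        (if a i && c then (-1 : ℝ) else 1) = 2 := by
      intro i
      cases a i <;> norm_num
    rw [Finset.prod_congr rfl fun i _ => this i]
    simp
  · obtain ⟨i, hi⟩ := Function.ne_iff.1 h
    refine Finset.prod_eq_zero (Finset.mem_univ i) ?_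
    revert hi
    cases a i <;> cases a' i <;> simp

theorem sylvester_parseval (r : ℕ) (c : (Fin r → Bool) → Bool) :
    ∑ a, (∑ b, bitSign (c b) * bitSign (sylvester r a b)) ^ 2 = ((2 : ℝ) ^ r) ^ 2 := by
  have h1 : ∀ a, (∑ b, bitSign (c b) * bitSign (sylvester r a b)) ^ 2 =
      ∑ b, ∑ b', bitSign (c b) * bitSign (c b') *
        (bitSign (sylvester r b a) * bitSign (sylvester r b' a)) := by
    intro a
    rw [sq, Finset.sum_mul_sum]
    refine Finset.sum_congr rfl fun b _ => Finset.sum_congr rfl fun b' _ => ?_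
    rw [sylvester_comm r a b, sylvester_comm r a b']
    ring
  simp only [h1]
  rw [Finset.sum_comm]
  have h2 : ∀ b, ∑ a, ∑ b', bitSign (c b) * bitSign (c b') *
      (bitSign (sylvester r b a) * bitSign (sylvester r b' a)) = (2 : ℝ) ^ r := by
    intro b
    rw [Finset.sum_comm]
    simp only [← Finset.mul_sum, sylvester_orthogonal]
    simp [← sq, bitSign_sq]
  simp only [h2]
  simp [sq]

/-! ### Tail and moment bounds for Rademacher sums. -/

/-- Moment generating function bound for Rademacher sums. -/
theorem sum_exp_rademacher_le {ι : Type*} [Fintype ι] [DecidableEq ι] (c : ι → ℝ) :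
    ∑ x : ι → Bool, Real.exp (∑ w, bitSign (x w) * c w) ≤
      2 ^ Fintype.card ι * Real.exp ((∑ w, c w ^ 2) / 2) := by
  simp only [Real.exp_sum]
  rw [← Fintype.prod_sum (fun (w : ι) (b : Bool) => Real.exp (bitSign b * c w)),
    Finset.sum_div, Real.exp_sum, ← Finset.card_univ, ← Finset.prod_const, ← Finset.prod_mul_distrib]
  refine Finset.prod_le_prod (fun w _ => by positivity) fun w _ => ?_
  have := Real.cosh_le_exp_half_sq (c w)
  rw [Real.cosh_eq] at this
  simp only [Fintype.sum_bool, bitSign]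
  simp only [if_true, one_mul, Bool.false_eq_true, if_false, neg_mul]
  linarith

/-- Hoeffding's inequality in counting form. -/
theorem card_rademacher_ge_le {ι : Type*} [Fintype ι] [DecidableEq ι] (c : ι → ℝ) {σ t : ℝ}
    (hσ : 0 < σ) (hc : ∑ w, c w ^ 2 = σ) (S : Finset (ι → Bool)) (ht : 0 ≤ t)
    (hS : ∀ x ∈ S, t ≤ ∑ w, bitSign (x w) * c w) :
    (S.card : ℝ) ≤ 2 ^ Fintype.card ι * Real.exp (-(t ^ 2 / (2 * σ))) := by
  have h := sum_exp_rademacher_le (fun w => t / σ * c w)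
  have h1 : (S.card : ℝ) * Real.exp (t / σ * t) ≤
      ∑ x : ι → Bool, Real.exp (∑ w, bitSign (x w) * (t / σ * c w)) := by
    rw [← nsmul_eq_mul, ← Finset.sum_const]
    refine (Finset.sum_le_sum fun x hx => ?_).trans
      (Finset.sum_le_sum_of_subset_of_nonneg (Finset.subset_univ S) fun _ _ _ => by positivity)
    have : ∑ w, bitSign (x w) * (t / σ * c w) = t / σ * ∑ w, bitSign (x w) * c w := by
      rw [Finset.mul_sum]
      exact Finset.sum_congr rfl fun _ _ => by ring
    rw [this]
    gcongr
    exact hS x hx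
  have h2 : (∑ w, (t / σ * c w) ^ 2) / 2 = t ^ 2 / (2 * σ) := by
    simp only [mul_pow, ← Finset.mul_sum, hc]
    field_simp
  rw [h2] at h
  have h3 : Real.exp (-(t ^ 2 / (2 * σ))) = Real.exp (t ^ 2 / (2 * σ)) / Real.exp (t / σ * t) := by
    rw [← Real.exp_sub]
    congr 1
    field_simp
    ring
  rw [h3, ← mul_div_assoc, le_div_iff₀ (Real.exp_pos _)]
  exact h1.trans h

theorem pow_four_le_exp (y : ℝ) : y ^ 4 ≤ 24 * (Real.exp y + Real.exp (-y)) := by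
  wlog h : 0 ≤ y generalizing y
  · have := this (-y) (by linarith)
    rw [neg_neg] at this
    nlinarith
  have := Real.pow_div_factorial_le_exp y h 4
  norm_num [Nat.factorial] at this
  have := Real.exp_pos (-y)
  linarith

/-- Fourth moment of a sign-weighted Rademacher sum. -/
theorem sum_rademacher_pow_four_le {ι : Type*} [Fintype ι] [DecidableEq ι] [Nonempty ι]
    (c : ι → Bool) :
    ∑ x : ι → Bool, (∑ w, bitSign (x w) * bitSign (c w)) ^ 4 ≤
      24 * 2 ^ Fintype.card ι * (Fintype.card ι : ℝ) ^ 2 := by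
  set m : ℝ := (Fintype.card ι : ℝ) with hm
  have hm0 : 0 < m := by rw [hm]; exact_mod_cast Fintype.card_pos
  -- At this scale the exponential moments at `±l` are bounded by the constant `exp 2`,
  -- independently of `m`.
  set l : ℝ := 2 / √m with hl
  have hl2 : l ^ 2 * m = 4 := by
    rw [hl, div_pow, Real.sq_sqrt hm0.le]
    field_simp
    norm_num
  have hl4 : l ^ 4 * m ^ 2 = 16 := by
    calc l ^ 4 * m ^ 2 = (l ^ 2 * m) ^ 2 := by ring
      _ = 16 := by rw [hl2]; norm_num
  have key : ∀ s : ℝ, s ^ 2 = l ^ 2 →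
      ∑ x : ι → Bool, Real.exp (s * ∑ w, bitSign (x w) * bitSign (c w)) ≤
        2 ^ Fintype.card ι * Real.exp 2 := by
    intro s hs
    have h := sum_exp_rademacher_le (fun w => s * bitSign (c w))
    have h1 : (∑ w, (s * bitSign (c w)) ^ 2) / 2 = 2 := by
      simp only [mul_pow, bitSign_sq, hs, mul_one, Finset.sum_const, Finset.card_univ,
        nsmul_eq_mul, ← hm]
      linarith
    rw [h1] at h
    refine le_trans (le_of_eq ?_) h
    refine Finset.sum_congr rfl fun x _ => ?_
    rw [Finset.mul_sum]
    congr 1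
    exact Finset.sum_congr rfl fun _ _ => by ring
  have hp := key l rfl
  have hn := key (-l) (by ring)
  have he : Real.exp 2 ≤ 8 := by
    have h1 := Real.exp_one_lt_d9
    have h2 : Real.exp 2 = Real.exp 1 * Real.exp 1 := by rw [← Real.exp_add]; norm_num
    have h3 := Real.exp_pos 1
    nlinarith
  have hsum : l ^ 4 * ∑ x : ι → Bool, (∑ w, bitSign (x w) * bitSign (c w)) ^ 4 ≤
      24 * (2 * (2 ^ Fintype.card ι * Real.exp 2)) := by
    rw [two_mul]
    refine le_trans ?_ (mul_le_mul_of_nonneg_left (add_le_add hp hn) (by norm_num))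
    rw [← Finset.sum_add_distrib, Finset.mul_sum, Finset.mul_sum]
    refine Finset.sum_le_sum fun x _ => ?_
    rw [← mul_pow, neg_mul]
    exact pow_four_le_exp _
  set Z := ∑ x : ι → Bool, (∑ w, bitSign (x w) * bitSign (c w)) ^ 4
  have hN : (0 : ℝ) < 2 ^ Fintype.card ι := by positivity
  have h4 : 16 * Z ≤ 16 * (24 * 2 ^ Fintype.card ι * m ^ 2) := by
    calc 16 * Z = (l ^ 4 * Z) * m ^ 2 := by rw [← hl4]; ring
      _ ≤ (24 * (2 * (2 ^ Fintype.card ι * Real.exp 2))) * m ^ 2 := by gcongr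
      _ ≤ (24 * (2 * (2 ^ Fintype.card ι * 8))) * m ^ 2 := by gcongr
      _ = _ := by ring
  linarith

/-! ### The hard graphs. -/

/-- The split graph on a clique `J` and an independent set `I × Bool` in which `q` is joined to
the vertices `(w, R q w)`. -/
def rowGraph {J I : Type*} (R : J → I → Bool) : SimpleGraph (J ⊕ I × Bool) where
  Adj
    | .inl q, .inl q' => q ≠ q'
    | .inl q, .inr z => R q z.1 = z.2
    | .inr z, .inl q => R q z.1 = z.2
    | .inr _, .inr _ => False
  symm := ⟨by rintro (q | z) (q' | z') h <;> first | exact h | exact Ne.symm h⟩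
  loopless := ⟨by rintro (q | z) h <;> first | exact h | exact h rfl⟩

theorem commonNeighbors_rowGraph_map {J I V : Type*} (R : J → I → Bool) (e : J ⊕ I × Bool ↪ V)
    (q q' : J) :
    ((rowGraph R).map e).commonNeighbors (e (.inl q)) (e (.inl q')) =
      e '' (Sum.inl '' {q, q'}ᶜ ∪ (fun w => Sum.inr (w, R q w)) '' {w | R q w = R q' w}) := by
  ext v
  simp only [SimpleGraph.mem_commonNeighbors]
  constructor
  · rintro ⟨h1, h2⟩
    obtain ⟨a, b, hab, ha, rfl⟩ := (SimpleGraph.map_adj ..).1 h1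
    have ha := e.injective ha
    subst ha
    have h2 := SimpleGraph.map_adj_apply.1 h2
    refine ⟨b, ?_, rfl⟩
    rcases b with b | ⟨w, b⟩
    · left
      refine ⟨b, ?_, rfl⟩
      have h3 : q ≠ b := hab
      have h4 : q' ≠ b := h2
      simp [h3.symm, h4.symm]
    · right
      have h3 : R q w = b := hab
      have h4 : R q' w = b := h2
      exact ⟨w, h3.trans h4.symm, by simp [h3]⟩
  · rintro ⟨b, hb, rfl⟩
    rw [SimpleGraph.map_adj_apply, SimpleGraph.map_adj_apply]
    rcases hb with ⟨b, hb, rfl⟩ | ⟨w, hw, rfl⟩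
    · simp only [Set.mem_compl_iff, Set.mem_insert_iff, Set.mem_singleton_iff, not_or] at hb
      exact ⟨Ne.symm hb.1, Ne.symm hb.2⟩
    · exact ⟨rfl, hw.symm⟩

theorem card_agree {I : Type*} [Fintype I] (a b : I → Bool) :
    (({w | a w = b w} : Set I).ncard : ℝ) =
      (Fintype.card I + ∑ w, bitSign (a w) * bitSign (b w)) / 2 := by
  classical
  have h : ∀ w, bitSign (a w) * bitSign (b w) = 2 * (if a w = b w then 1 else 0) - 1 := by
    intro w
    cases a w <;> cases b w <;> norm_num [bitSign]
  simp only [h, Finset.sum_sub_distrib, ← Finset.mul_sum, Finset.sum_boole]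
  rw [Set.ncard_eq_toFinset_card', Set.toFinset_ofPred]
  simp

/-- All other clique vertices are common neighbours, and each pair contributes one exactly when the
two rows agree there. -/
theorem vertexConn_rowGraph_map {J I V : Type*} [Fintype J] [Fintype I] [Finite V]
    (R : J → I → Bool) (e : J ⊕ I × Bool ↪ V) {q q' : J} (hq : q ≠ q') :
    (vertexConn ((rowGraph R).map e) (e (.inl q)) (e (.inl q')) : ℝ) =
      Fintype.card J - 1 + (Fintype.card I + ∑ w, bitSign (R q w) * bitSign (R q' w)) / 2 := by
  rw [vertexConn_of_split _ (e '' Set.range Sum.inl) ?_ ?_ ⟨_, ⟨q, rfl⟩, rfl⟩ ⟨_, ⟨q', rfl⟩, rfl⟩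
    (fun h => hq (Sum.inl_injective (e.injective h))), commonNeighbors_rowGraph_map,
    Set.ncard_image_of_injective _ e.injective, Set.ncard_union_eq,
    Set.ncard_image_of_injective _ Sum.inl_injective, Set.ncard_image_of_injective]
  · have h := Set.ncard_add_ncard_compl ({q, q'} : Set J)
    rw [Set.ncard_pair hq, Nat.card_eq_fintype_card] at h
    have h' : (2 : ℝ) + (({q, q'} : Set J)ᶜ.ncard : ℝ) = Fintype.card J := by exact_mod_cast h
    push_cast
    rw [card_agree, ← h']
    ring
  · intro w w' h
    simp only [Sum.inr.injEq, Prod.mk.injEq] at h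
    exact h.1
  · rw [Set.disjoint_left]
    rintro _ ⟨b, _, rfl⟩ ⟨w, _, h⟩
    exact absurd h (by simp)
  · rintro _ ⟨_, ⟨a, rfl⟩, rfl⟩ _ ⟨_, ⟨b, rfl⟩, rfl⟩ hab
    rw [SimpleGraph.map_adj_apply]
    exact fun h => hab (by rw [h])
  · intro a ha b hb hadj
    obtain ⟨a', b', -, rfl, rfl⟩ := (SimpleGraph.map_adj ..).1 hadj
    rw [SimpleGraph.map_adj_apply] at hadj
    rcases a' with a' | a'
    · exact ha ⟨_, ⟨a', rfl⟩, rfl⟩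
    · rcases b' with b' | b'
      · exact hb ⟨_, ⟨b', rfl⟩, rfl⟩
      · exact hadj

/-! ### Typical vectors and sign patterns. -/

/-- Correlation of a bit vector with a row of the Sylvester–Hadamard matrix. -/
def rowCorr (r : ℕ) (x : (Fin r → Bool) → Bool) (j : Fin r → Bool) : ℝ :=
  ∑ w, bitSign (x w) * bitSign (sylvester r j w)

open Classical in
/-- The bit vectors whose Sylvester–Hadamard transform has a small fourth moment. -/
noncomputable def typicalRows (r : ℕ) : Finset ((Fin r → Bool) → Bool) :=
  {x | ∑ j, rowCorr r x j ^ 4 ≤ 48 * ((2 : ℝ) ^ r) ^ 3}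

/-- Markov's inequality: the mean of the sum of fourth powers is at most half the threshold. -/
theorem half_le_card_typicalRows (r : ℕ) :
    (2 : ℝ) ^ 2 ^ r / 2 ≤ ((typicalRows r).card : ℝ) := by
  classical
  have hm : (0 : ℝ) < 2 ^ r := by positivity
  have hI : Fintype.card (Fin r → Bool) = 2 ^ r := by simp
  have h1 : ∑ x, ∑ j, rowCorr r x j ^ 4 ≤ 24 * 2 ^ 2 ^ r * ((2 : ℝ) ^ r) ^ 3 := by
    rw [Finset.sum_comm]
    refine (Finset.sum_le_sum fun j _ => sum_rademacher_pow_four_le (sylvester r j)).trans ?_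
    rw [Finset.sum_const, Finset.card_univ, hI, nsmul_eq_mul]
    push_cast
    apply le_of_eq
    ring
  have h2 : (((typicalRows r)ᶜ).card : ℝ) * (48 * ((2 : ℝ) ^ r) ^ 3) ≤
      ∑ x, ∑ j, rowCorr r x j ^ 4 := by
    rw [← nsmul_eq_mul, ← Finset.sum_const]
    refine (Finset.sum_le_sum fun x hx => ?_).trans
      (Finset.sum_le_sum_of_subset_of_nonneg (Finset.subset_univ _) fun _ _ _ => by positivity)
    simp only [typicalRows, Finset.mem_compl, Finset.mem_filter, Finset.mem_univ, true_and,
      not_le] at hx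
    exact hx.le
  have h3 : ((typicalRows r).card : ℝ) + ((typicalRows r)ᶜ.card : ℝ) = 2 ^ 2 ^ r := by
    have := Finset.card_add_card_compl (typicalRows r)
    rw [Fintype.card_fun, hI, Fintype.card_bool] at this
    exact_mod_cast this
  have h4 : (((typicalRows r)ᶜ).card : ℝ) * 2 ≤ 2 ^ 2 ^ r := by
    have h5 : (0 : ℝ) < 24 * (2 ^ r) ^ 3 := by positivity
    refine le_of_mul_le_mul_right ?_ h5
    linarith
  linarith

/-- The second moment is fixed by Parseval and the fourth is bounded, so the mass cannot sit on few
entries. Quantitatively, `t ^ 2 - t ^ 4 ≤ t` is summed over `t = |rowCorr| / (12 * √m)`; the scale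
12 makes the quartic loss `m / 432` smaller than the quadratic gain `m / 144`. -/
theorem le_sum_abs_rowCorr (r : ℕ) {x : (Fin r → Bool) → Bool} (hx : x ∈ typicalRows r) :
    2 ^ r * √(2 ^ r) / 18 ≤ ∑ j, |rowCorr r x j| := by
  classical
  simp only [typicalRows, Finset.mem_filter, Finset.mem_univ, true_and] at hx
  have h2 : ∑ j, rowCorr r x j ^ 2 = ((2 : ℝ) ^ r) ^ 2 := sylvester_parseval r x
  set m : ℝ := 2 ^ r with hm
  have hm0 : 0 < m := by positivity
  have hs : √m ^ 2 = m := Real.sq_sqrt hm0.le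
  have hs0 : 0 < √m := Real.sqrt_pos.2 hm0
  set s := √m
  have key : ∀ t : ℝ, 0 ≤ t → t ^ 2 - t ^ 4 ≤ t := by
    intro t ht
    rcases le_total t 1 with h | h
    · nlinarith [sq_nonneg (t ^ 2)]
    · nlinarith [mul_nonneg (sq_nonneg t) (sub_nonneg.2 h), mul_nonneg (mul_nonneg (sq_nonneg t) (sub_nonneg.2 h)) ht]
  have h3 : ∀ j, rowCorr r x j ^ 2 / (144 * m) - rowCorr r x j ^ 4 / (144 ^ 2 * m ^ 2) ≤
      |rowCorr r x j| / (12 * s) := by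
    intro j
    have := key (|rowCorr r x j| / (12 * s)) (by positivity)
    have e2 : (|rowCorr r x j| / (12 * s)) ^ 2 = rowCorr r x j ^ 2 / (144 * m) := by
      rw [div_pow, sq_abs, mul_pow, hs]
      norm_num
    have e4 : (|rowCorr r x j| / (12 * s)) ^ 4 = rowCorr r x j ^ 4 / (144 ^ 2 * m ^ 2) := by
      calc (|rowCorr r x j| / (12 * s)) ^ 4 = ((|rowCorr r x j| / (12 * s)) ^ 2) ^ 2 := by ring
        _ = _ := by rw [e2, div_pow]; ring
    rwa [e2, e4] at this
  have h4 := Finset.sum_le_sum fun j (_ : j ∈ Finset.univ) => h3 j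
  rw [Finset.sum_sub_distrib, ← Finset.sum_div, ← Finset.sum_div, ← Finset.sum_div, h2] at h4
  have h5 : (∑ j, rowCorr r x j ^ 4) / (144 ^ 2 * m ^ 2) ≤ 48 * m ^ 3 / (144 ^ 2 * m ^ 2) := by
    gcongr
  have h6 : m ^ 2 / (144 * m) = m / 144 := by field_simp
  have h7 : 48 * m ^ 3 / (144 ^ 2 * m ^ 2) = m / 432 := by field_simp; norm_num
  have h8 : m / 216 ≤ (∑ j, |rowCorr r x j|) / (12 * s) := by linarith
  rw [le_div_iff₀ (by positivity)] at h8
  linarith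

/-- Few typical bit vectors are compatible with a given pattern of approximate signs of their
Sylvester–Hadamard transform. -/
theorem card_consistent_le (r : ℕ) (a : (Fin r → Bool) → Bool) {τ : ℝ}
    (hτ : 2 * τ ≤ √(2 ^ r) / 32) (S : Finset ((Fin r → Bool) → Bool)) (hS : S ⊆ typicalRows r)
    (hc : ∀ x ∈ S, ∀ j, -τ ≤ bitSign (a j) * rowCorr r x j) :
    (S.card : ℝ) ≤ 2 ^ 2 ^ r * Real.exp (-(2 ^ r / 8192)) := by
  have hI : Fintype.card (Fin r → Bool) = 2 ^ r := by simp
  set m : ℝ := 2 ^ r with hm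
  have hm0 : 0 < m := by positivity
  have hs : √m ^ 2 = m := Real.sq_sqrt hm0.le
  have h := card_rademacher_ge_le (fun w => ∑ j, bitSign (a j) * bitSign (sylvester r w j))
    -- Parseval for the pattern `a` gives `σ`; `t` is admissible since `1/18 - 1/32 ≥ 1/64`.
    (σ := m ^ 2) (t := m * √m / 64) (by positivity) (sylvester_parseval r a) S (by positivity) ?_
  · rw [hI] at h
    convert h using 4
    rw [div_pow, mul_pow, hs]
    field_simp
    norm_num
  · intro x hx
    have h1 : ∑ w, bitSign (x w) * ∑ j, bitSign (a j) * bitSign (sylvester r w j) =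
        ∑ j, bitSign (a j) * rowCorr r x j := by
      simp only [rowCorr, Finset.mul_sum]
      rw [Finset.sum_comm]
      refine Finset.sum_congr rfl fun j _ => Finset.sum_congr rfl fun w _ => ?_
      rw [sylvester_comm r w j]
      ring
    rw [h1]
    -- A wrong sign occurs only where `|rowCorr r x j| ≤ τ`, and costs at most `2 * τ`.
    have h2 : ∑ j, (|rowCorr r x j| - √m / 32) ≤ ∑ j, bitSign (a j) * rowCorr r x j := by
      refine Finset.sum_le_sum fun j _ => ?_
      have h3 := hc x hx j
      have h4 : 0 ≤ √m := Real.sqrt_nonneg m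
      have h5 : bitSign (a j) * rowCorr r x j = rowCorr r x j ∨
          bitSign (a j) * rowCorr r x j = -rowCorr r x j := by
        cases a j <;> simp [bitSign]
      rcases h5 with h5 | h5 <;> rw [h5] at h3 ⊢ <;>
        cases abs_cases (rowCorr r x j) <;> linarith
    refine le_trans ?_ h2
    rw [Finset.sum_sub_distrib, Finset.sum_const, Finset.card_univ, hI, nsmul_eq_mul]
    have h6 := le_sum_abs_rowCorr r (hS hx)
    push_cast
    rw [← hm] at h6 ⊢
    have : 0 ≤ m * √m := by positivity
    linarith

/-! ### Counting encodings. -/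

theorem card_lists_length_le {s : ℕ} (L : Finset (List Bool)) (hL : ∀ l ∈ L, l.length ≤ s) :
    L.card ≤ 2 ^ (s + 1) := by
  classical
  have h : L ⊆ (Finset.range (s + 1)).biUnion
      fun i => (Finset.univ : Finset (Fin i → Bool)).image List.ofFn := by
    intro l hl
    simp only [Finset.mem_biUnion, Finset.mem_range, Finset.mem_image, Finset.mem_univ, true_and]
    exact ⟨l.length, Nat.lt_succ_of_le (hL l hl), l.get, List.ofFn_get l⟩
  refine (Finset.card_le_card h).trans (Finset.card_biUnion_le.trans ?_)
  refine (Finset.sum_le_sum fun i _ => Finset.card_image_le).trans ?_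
  simp only [Finset.card_univ, Fintype.card_fun, Fintype.card_bool, Fintype.card_fin]
  have : ∀ n, ∑ i ∈ Finset.range n, 2 ^ i + 1 = 2 ^ n := by
    intro n
    induction n with
    | zero => simp
    | succ n ih => rw [Finset.sum_range_succ, pow_succ]; omega
  exact (Nat.le_succ _).trans (this _).le

theorem ApproxConnDS.length_encode_le_space {n k : ℕ} {ε : ℝ} (D : ApproxConnDS n k ε)
    (G : SimpleGraph (Fin n)) : (D.encode G).length ≤ D.space :=
  Finset.le_sup (f := fun G => (D.encode G).length) (by simp)

/-- Quadratic space lower bound for data structures with accuracy `O(√k)` in absolute terms. -/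
theorem ApproxConnDS.sq_le_space {n k r : ℕ} {ε : ℝ} (D : ApproxConnDS n k ε)
    (hn : 8 * 2 ^ r ≤ n) (hk : (k : ℝ) = 5 * 2 ^ r - 1)
    (hε : 4 * (ε * k) ≤ √(2 ^ (r + 1)) / 32) :
    ((2 : ℝ) ^ (r + 1)) ^ 2 / 8192 ≤ D.space + 1 + 2 ^ (r + 1) := by
  classical
  let I := Fin (r + 1) → Bool
  have hI : Fintype.card I = 2 ^ (r + 1) := by simp [I]
  have hcard : Fintype.card ((I ⊕ I) ⊕ I × Bool) ≤ Fintype.card (Fin n) := by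
    simp only [Fintype.card_sum, Fintype.card_prod, hI, Fintype.card_bool, Fintype.card_fin]
    rw [pow_succ]
    omega
  obtain ⟨e⟩ := Function.Embedding.nonempty_of_card_le hcard
  let G : (I → I → Bool) → SimpleGraph (Fin n) := fun x =>
    (rowGraph (Sum.elim x (sylvester (r + 1)))).map e
  have hconn : ∀ x d j, (vertexConn (G x) (e (.inl (.inl d))) (e (.inl (.inr j))) : ℝ) =
      k + rowCorr (r + 1) (x d) j / 2 := by
    intro x d j
    rw [vertexConn_rowGraph_map _ e (by simp), Fintype.card_sum, hI, hk, rowCorr]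
    simp only [Sum.elim_inl, Sum.elim_inr]
    push_cast
    ring
  let a : List Bool → I → I → Bool := fun l d j =>
    D.query l (e (.inl (.inl d))) (e (.inl (.inr j)))
  -- The factor 2 arises because connectivity deviates from `k` by half the correlation.
  have ha : ∀ x d j, -(2 * (ε * k)) ≤
      bitSign (a (D.encode (G x)) d j) * rowCorr (r + 1) (x d) j := by
    intro x d j
    have hne : e (.inl (.inl d)) ≠ e (.inl (.inr j)) := fun h => by simpa using e.injective h
    have h1 := D.query_of_lt (G x) _ _ hne
    have h2 := D.query_of_gt (G x) _ _ hne
    rw [hconn] at h1 h2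
    cases h : a (D.encode (G x)) d j
    · have h3 := mt h2 (by rw [show D.query _ _ _ = false from h]; simp)
      simp only [bitSign, Bool.false_eq_true, if_false]
      linarith
    · have h3 := mt h1 (by rw [show D.query _ _ _ = true from h]; simp)
      simp only [bitSign, if_true]
      linarith
  let X : Finset (I → I → Bool) := Fintype.piFinset fun _ => typicalRows (r + 1)
  let B : ℝ := 2 ^ 2 ^ (r + 1) * Real.exp (-(2 ^ (r + 1) / 8192))
  -- The string fixes all answers, and these constrain each data row separately.
  have hfib : ∀ l, (({x ∈ X | D.encode (G x) = l}.card : ℕ) : ℝ) ≤ B ^ 2 ^ (r + 1) := by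
    intro l
    let C : I → Finset (I → Bool) := fun d =>
      {y ∈ typicalRows (r + 1) | ∀ j, -(2 * (ε * k)) ≤ bitSign (a l d j) * rowCorr (r + 1) y j}
    have hsub : {x ∈ X | D.encode (G x) = l} ⊆ Fintype.piFinset C := by
      intro x hx
      obtain ⟨hxX, rfl⟩ := Finset.mem_filter.1 hx
      rw [Fintype.mem_piFinset] at hxX ⊢
      exact fun d => Finset.mem_filter.2 ⟨hxX d, ha x d⟩
    have h1 : ((Fintype.piFinset C).card : ℝ) ≤ B ^ 2 ^ (r + 1) := by
      rw [Fintype.card_piFinset, ← hI, ← Finset.card_univ, ← Finset.prod_const]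
      push_cast
      refine Finset.prod_le_prod (fun _ _ => by positivity) fun d _ => ?_
      exact card_consistent_le (r + 1) (a l d) (by linarith) _ (Finset.filter_subset _ _)
        fun y hy => (Finset.mem_filter.1 hy).2
    exact le_trans (by exact_mod_cast Finset.card_le_card hsub) h1
  have hX : (X.card : ℝ) ≤ 2 ^ (D.space + 1) * B ^ 2 ^ (r + 1) := by
    rw [Finset.card_eq_sum_card_image (fun x => D.encode (G x)) X]
    push_cast
    refine (Finset.sum_le_sum fun l _ => hfib l).trans ?_
    rw [Finset.sum_const, nsmul_eq_mul]
    have : (X.image fun x => D.encode (G x)).card ≤ 2 ^ (D.space + 1) := by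
      apply card_lists_length_le
      intro l hl
      obtain ⟨x, -, rfl⟩ := Finset.mem_image.1 hl
      exact D.length_encode_le_space (G x)
    gcongr
    exact_mod_cast this
  have hX' : ((2 : ℝ) ^ 2 ^ (r + 1) / 2) ^ 2 ^ (r + 1) ≤ X.card := by
    rw [Fintype.card_piFinset, Finset.prod_const, Finset.card_univ, hI]
    push_cast
    gcongr
    exact half_le_card_typicalRows (r + 1)
  have h := hX'.trans hX
  simp only [B, div_pow, mul_pow] at h
  rw [← Real.exp_nat_mul, mul_left_comm, div_eq_mul_inv] at h
  have h := le_of_mul_le_mul_left h (by positivity)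
  rw [inv_le_iff_one_le_mul₀ (by positivity)] at h
  have h2 : ∀ s : ℕ, (2 : ℝ) ^ s ≤ Real.exp s := by
    intro s
    rw [← Real.exp_one_pow]
    gcongr
    linarith [Real.add_one_le_exp (1 : ℝ)]
  have h3 : (1 : ℝ) ≤ Real.exp ((D.space + 1 : ℕ) + ((2 ^ (r + 1) : ℕ) : ℝ) *
      (-(2 ^ (r + 1) / 8192)) + (2 ^ (r + 1) : ℕ)) := by
    rw [Real.exp_add, Real.exp_add]
    refine h.trans ?_
    gcongr
    · exact h2 _
    · exact h2 _
  have h4 := Real.one_le_exp_iff.1 h3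
  push_cast at h4
  have h5 : ((2 : ℝ) ^ (r + 1)) ^ 2 / 8192 = 2 ^ (r + 1) * (2 ^ (r + 1) / 8192) := by ring
  rw [h5]
  linarith

/-! ### Choice of parameters. -/

theorem corollary3p4 :
    ∃ (k : ℕ → ℕ) (ε : ℕ → ℝ) (c : ℝ),
      (∀ n, 0 < ε n ∧ ε n < 1) ∧
      (fun n => (k n : ℝ)) =Θ[atTop] (fun n => (n : ℝ)) ∧
      ε =Θ[atTop] (fun n => 1 / Real.sqrt n) ∧
      0 < c ∧
      ∀ᶠ n in atTop, ∀ D : ApproxConnDS n (k n) (ε n),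
        c * (n * (ε n ^ 2)⁻¹) ≤ (D.space : ℝ) := by
  have hr : ∀ n : ℕ, 8 ≤ n → 8 * 2 ^ Nat.log 2 (n / 8) ≤ n ∧ n < 16 * 2 ^ Nat.log 2 (n / 8) := by
    intro n hn
    have h1 := Nat.pow_log_le_self 2 (x := n / 8) (by omega)
    have h2 := Nat.lt_pow_succ_log_self (b := 2) (by norm_num) (n / 8)
    rw [pow_succ] at h2
    omega
  have hk : ∀ r : ℕ, ((5 * 2 ^ r - 1 : ℕ) : ℝ) = 5 * 2 ^ r - 1 := by
    intro r
    have : 1 ≤ 5 * 2 ^ r := by have := Nat.one_le_two_pow (n := r); omega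
    push_cast [Nat.cast_sub this]
    rfl
  -- The largest power of two with `8 * 2 ^ r ≤ n` is used. The shift `n + 1` keeps `ε 0` positive,
  -- and 160 gives `4 * (ε * k) ≤ √(2 ^ (r + 1)) / 32`.
  refine ⟨fun n => 5 * 2 ^ Nat.log 2 (n / 8) - 1, fun n => 1 / (160 * √(n + 1)),
    1 / (51200 * 2 ^ 20), ?_, ⟨?_, ?_⟩, ⟨?_, ?_⟩, by norm_num, ?_⟩
  · intro n
    have h1 : 1 ≤ √((n : ℝ) + 1) := Real.one_le_sqrt.2 (by linarith [n.cast_nonneg (α := ℝ)])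
    refine ⟨by positivity, ?_⟩
    rw [div_lt_one (by positivity)]
    linarith
  · refine IsBigO.of_bound 1 ?_
    filter_upwards [eventually_ge_atTop 8] with n hn
    rw [Real.norm_natCast, Real.norm_natCast, one_mul]
    exact_mod_cast (by have := hr n hn; omega)
  · refine IsBigO.of_bound 16 ?_
    filter_upwards [eventually_ge_atTop 8] with n hn
    rw [Real.norm_natCast, Real.norm_natCast]
    exact_mod_cast (by have := hr n hn; omega)
  · refine IsBigO.of_bound 1 ?_
    filter_upwards [eventually_ge_atTop 1] with n hn
    have hn' : (0 : ℝ) < n := by exact_mod_cast hn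
    rw [Real.norm_of_nonneg (by positivity), Real.norm_of_nonneg (by positivity), one_mul]
    have h1 : √(n : ℝ) ≤ √((n : ℝ) + 1) := Real.sqrt_le_sqrt (by linarith)
    have h2 : 0 < √(n : ℝ) := Real.sqrt_pos.2 hn'
    apply one_div_le_one_div_of_le h2
    linarith
  · refine IsBigO.of_bound 320 ?_
    filter_upwards [eventually_ge_atTop 1] with n hn
    have hn' : (1 : ℝ) ≤ n := by exact_mod_cast hn
    rw [Real.norm_of_nonneg (by positivity), Real.norm_of_nonneg (by positivity)]
    have h1 : √((n : ℝ) + 1) ≤ 2 * √(n : ℝ) := by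
      rw [show (2 : ℝ) * √(n : ℝ) = √(4 * n) by
        rw [Real.sqrt_mul (by norm_num), show (4 : ℝ) = 2 ^ 2 by norm_num,
          Real.sqrt_sq (by norm_num)]]
      exact Real.sqrt_le_sqrt (by linarith)
    have h2 : 0 < √(n : ℝ) := Real.sqrt_pos.2 (by linarith)
    rw [mul_one_div, div_le_div_iff₀ h2 (by positivity)]
    linarith
  -- This threshold forces `2 ^ r > 16384`, so the linear loss `1 + 2 ^ (r + 1)` is absorbed by the
  -- quadratic term.
  · filter_upwards [eventually_ge_atTop (8 * 32768)] with n hn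
    obtain ⟨h1, h2⟩ := hr n (by omega)
    generalize Nat.log 2 (n / 8) = r at h1 h2 ⊢
    intro D
    have hn1 : 8 * (2 : ℝ) ^ r ≤ n := by exact_mod_cast h1
    have hn2 : (n : ℝ) < 16 * 2 ^ r := by exact_mod_cast h2
    have hn3 : (8 * 32768 : ℝ) ≤ n := by exact_mod_cast hn
    have hp : (0 : ℝ) < 2 ^ r := by positivity
    have hs := D.sq_le_space h1 (hk r) ?_
    · have h3 : ((1 / (160 * √((n : ℝ) + 1))) ^ 2)⁻¹ = 25600 * ((n : ℝ) + 1) := by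
        rw [div_pow, mul_pow, Real.sq_sqrt (by positivity)]
        norm_num
      rw [h3]
      rw [pow_succ (2 : ℝ) r] at hs
      set p : ℝ := 2 ^ r
      have h4 : (n : ℝ) * (n + 1) ≤ 2 * n ^ 2 := by nlinarith
      have h5 : (n : ℝ) ^ 2 ≤ 256 * p ^ 2 := by nlinarith
      have h6 : p * 16384 ≤ p ^ 2 := by nlinarith
      linarith
    · rw [hk r]
      have h3 : 2 * √(2 ^ (r + 1)) ≤ √((n : ℝ) + 1) := by
        apply Real.le_sqrt_of_sq_le
        rw [mul_pow, Real.sq_sqrt (by positivity), pow_succ (2 : ℝ) r]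
        linarith
      have h4 : √((2 : ℝ) ^ (r + 1)) ^ 2 = 2 * 2 ^ r := by
        rw [Real.sq_sqrt (by positivity), pow_succ (2 : ℝ) r]
        ring
      have h5 : 0 < √((2 : ℝ) ^ (r + 1)) := Real.sqrt_pos.2 (by positivity)
      rw [one_div_mul_eq_div, ← mul_div_assoc, div_le_iff₀ (by positivity)]
      nlinarith
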